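/- Let $2\le p\le q$ be integers and let $$BS(p,q)=\langle a,t \mid t a^p t^{-1}=a^q\rangle$$ be the Baumslag--Solitar group. For $x\in BS(p,q)$ let $\|x\|$ be the least length of a word in $a^{\pm1},t^{\pm1}$ representing $x$, let $\gamma(n)=\#\{x\in BS(p,q):\|x\|\le n\}$, and let the growth rate of $BS(p,q)$ be $\lim_{n\to\infty}\gamma(n)^{1/n}$ (this limit exists). Put $k=\lfloor p/2\rfloor$, $\ell=\lfloor q/2\rfloor$, and $$C_k=\begin{cases}1&\text{if }p=2k\\2&\text{if }p=2k+1\end{cases}\qquad C_\ell=\begin{cases}1&\text{if }q=2\ell\\2&\text{if }q=2\ell+1.\end{cases}$$ Define the polynomial $P_{pq}$ as follows. If $p\ge4$, $$P_{pq}(x)=x^{\ell+1}-x^{\ell}-2(x^{\ell-1}+x^{\ell-2}+\dots+x^{\ell-k+1})-C_kx^{\ell-k}-2(x^{\ell-1}+x^{\ell-2}+\dots+x)-C_\ell .$$ In the remaining cases $p\in\{2,3\}$, $$\begin{aligned} P_{22}(x)&=x^2-x-2,\\ P_{23}(x)&=x^2-x-3,\\ P_{2q}(x)&=x^{\ell+1}-x^{\ell}-x^{\ell-1}-2(x^{\ell-1}+x^{\ell-2}+\dots+x)-C_\ell\quad(q\ge4),\\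 P_{33}(x)&=x^2-x-4,\\ P_{3q}(x)&=x^{\ell+1}-x^{\ell}-2x^{\ell-1}-2(x^{\ell-1}+x^{\ell-2}+\dots+x)-C_\ell\quad(q\ge4). \end{aligned}$$ Then $P_{pq}$ has a largest real zero, and the growth rate of $BS(p,q)$ is at least this zero. -/

import Mathlib

open Polynomial Filter Topology

noncomputable section

/-- The two generator symbols of a Baumslag--Solitar group. -/
inductive BSGen : Type
  | a
  | t

/-- The Baumslag--Solitar group `BS(p,q) = ⟨a, t ∣ t a^p t⁻¹ = a^q⟩`. -/
abbrev BS (p q : ℕ) : Type :=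
  PresentedGroup
    ({FreeGroup.of BSGen.t * FreeGroup.of BSGen.a ^ p * (FreeGroup.of BSGen.t)⁻¹ *
        (FreeGroup.of BSGen.a ^ q)⁻¹} : Set (FreeGroup BSGen))

/-- The standard generating set `{a, t}` of `BS(p,q)`. -/
def BS.gens (p q : ℕ) : Set (BS p q) :=
  {PresentedGroup.of BSGen.a, PresentedGroup.of BSGen.t}

/-- Word length of `x` with respect to `S`: the least length of a word in `S ∪ S⁻¹` that
represents `x` (and `⊤` if `x` is not in the subgroup generated by `S`). -/
def wordLength {G : Type*} [Group G] (S : Set G) (x : G) : ℕ∞ :=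
  ⨅ (w : List G) (_ : (∀ g ∈ w, g ∈ S ∨ g⁻¹ ∈ S) ∧ w.prod = x), (w.length : ℕ∞)

/-- The growth function `γ(n) = #{x : ‖x‖ ≤ n}`. -/
def growthFunction {G : Type*} [Group G] (S : Set G) (n : ℕ) : ℕ :=
  {x : G | wordLength S x ≤ n}.ncard

/-- The exponential growth rate `limsup γ(n)^(1/n)`. -/
def growthRate {G : Type*} [Group G] (S : Set G) : ℝ :=
  limsup (fun n : ℕ => (growthFunction S n : ℝ) ^ (1 / (n : ℝ))) atTop

/-- The constant attached to `n`: it is `1` if `n` is even and `2` if `n` is odd. -/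
def parityConst (n : ℕ) : ℝ :=
  if Even n then 1 else 2

/-- The polynomial `P_{pq}` (meaningful for `2 ≤ p ≤ q`), with `k = ⌊p/2⌋` and `ℓ = ⌊q/2⌋`. -/
def growthPoly (p q : ℕ) : ℝ[X] :=
  let k := p / 2
  let l := q / 2
  if 4 ≤ p then
    X ^ (l + 1) - X ^ l - 2 * ∑ i ∈ Finset.Icc (l - k + 1) (l - 1), X ^ i
      - C (parityConst p) * X ^ (l - k) - 2 * ∑ i ∈ Finset.Icc 1 (l - 1), X ^ i
      - C (parityConst q)
  else if p = 3 then
    if q = 3 then X ^ 2 - X - 4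
    else
      X ^ (l + 1) - X ^ l - 2 * X ^ (l - 1) - 2 * ∑ i ∈ Finset.Icc 1 (l - 1), X ^ i
        - C (parityConst q)
  else
    if q = 2 then X ^ 2 - X - 2
    else if q = 3 then X ^ 2 - X - 3
    else
      X ^ (l + 1) - X ^ l - X ^ (l - 1) - 2 * ∑ i ∈ Finset.Icc 1 (l - 1), X ^ i
        - C (parityConst q)

end

/-! ### Growth functions of finitely generated groups, and lower bounds from embedded free monoids.
-/

section WordGrowth

variable {G : Type*} [Group G] {S : Set G}

/-! `BS p q` maps to the HNN extension of `⟨a⟩` identifying `⟨a ^ p⟩` with `⟨a ^ q⟩`. There,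
products of syllables `t ^ u * a ^ r`, with `r` a balanced residue mod `p` (`u = 1`) or mod `q` (`u
= -1`), are distinct provided that a syllable with `r = 0` is followed by one of the same sign. Such
a syllable may thus copy its sign from the right, so one blank letter stands for both signs and the
codes form a free monoid, embedded by `Syllable.eval_injective`.

Weighting a syllable by its length `1 + |r|`, the alphabet has a generating function `f`, and
`P_{pq}(x) = x ^ (ℓ + 1) * (1 - f(1/x))` (`eval_growthPoly_eq_mul`). A positive zero `ρ` hence
satisfies `f(1/ρ) = 1`, and `le_growthRate_of_injective` bounds the growth rate below by `ρ`. -/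

theorem wordLength_le_iff {x : G} {n : ℕ} :
    wordLength S x ≤ n ↔
      ∃ w : List G, (∀ g ∈ w, g ∈ S ∨ g⁻¹ ∈ S) ∧ w.prod = x ∧ w.length ≤ n := by
  constructor
  · intro h
    -- A strict bound on an infimum yields a witness; integrality makes `≤ n` strict.
    have h' : wordLength S x < (n + 1 : ℕ) :=
      lt_of_le_of_lt h (by exact_mod_cast Nat.lt_succ_self n)
    simp only [wordLength, iInf_lt_iff] at h'
    obtain ⟨w, hw, hlt⟩ := h'
    exact ⟨w, hw.1, hw.2, Nat.lt_succ_iff.1 (by exact_mod_cast hlt)⟩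
  · rintro ⟨w, hw, hx, hn⟩
    exact (iInf₂_le w ⟨hw, hx⟩).trans (by exact_mod_cast hn)

theorem wordLength_mul_le {x y : G} {m n : ℕ} (hx : wordLength S x ≤ m)
    (hy : wordLength S y ≤ n) : wordLength S (x * y) ≤ (m + n : ℕ) := by
  obtain ⟨v, hv, rfl, hm⟩ := wordLength_le_iff.1 hx
  obtain ⟨w, hw, rfl, hn⟩ := wordLength_le_iff.1 hy
  refine wordLength_le_iff.2 ⟨v ++ w, ?_, by simp, by simp; omega⟩
  intro g hg
  rcases List.mem_append.1 hg with h | h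
  exacts [hv g h, hw g h]

theorem wordLength_one_le (n : ℕ) : wordLength S (1 : G) ≤ n :=
  wordLength_le_iff.2 ⟨[], by simp, by simp, by simp⟩

theorem wordLength_zpow_le {g : G} (hg : g ∈ S) (r : ℤ) : wordLength S (g ^ r) ≤ r.natAbs := by
  obtain ⟨n, rfl | rfl⟩ := r.eq_nat_or_neg
  · exact wordLength_le_iff.2 ⟨List.replicate n g,
      fun x hx => .inl (List.eq_of_mem_replicate hx ▸ hg), by simp, by simp⟩
  · exact wordLength_le_iff.2 ⟨List.replicate n g⁻¹,
      fun x hx => .inr (by rw [List.eq_of_mem_replicate hx, inv_inv]; exact hg), by simp, by simp⟩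

theorem exists_mul_of_wordLength_le_add {x : G} {m n : ℕ}
    (hx : wordLength S x ≤ (m + n : ℕ)) :
    ∃ y z : G, wordLength S y ≤ m ∧ wordLength S z ≤ n ∧ y * z = x := by
  obtain ⟨w, hw, rfl, hn⟩ := wordLength_le_iff.1 hx
  refine ⟨(w.take m).prod, (w.drop m).prod,
    wordLength_le_iff.2 ⟨_, fun g hg => hw g (List.mem_of_mem_take hg), rfl, by simp⟩,
    wordLength_le_iff.2 ⟨_, fun g hg => hw g (List.mem_of_mem_drop hg), rfl, by simp; omega⟩, ?_⟩
  rw [← List.prod_append, List.take_append_drop]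

/-- Without finiteness of balls, `ncard` in `growthFunction` could take its default value 0. -/
theorem finite_wordLength_le (hS : S.Finite) (n : ℕ) : {x : G | wordLength S x ≤ n}.Finite := by
  induction n with
  | zero =>
    refine (Set.finite_singleton (1 : G)).subset fun x hx => ?_
    obtain ⟨w, -, rfl, hn⟩ := wordLength_le_iff.1 hx
    rw [List.length_eq_zero_iff.1 (Nat.le_zero.1 hn)]
    simp
  | succ n ih =>
    have h1 : {x : G | wordLength S x ≤ (1 : ℕ)}.Finite := by
      refine ((hS.union hS.inv).union (Set.finite_singleton (1 : G))).subset fun x hx => ?_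
      obtain ⟨w, hw, rfl, hn⟩ := wordLength_le_iff.1 hx
      match w with
      | [] => simp
      | [g] => simpa using Or.inr (hw g (by simp))
      | _ :: _ :: _ => simp at hn
    refine (Set.Finite.image2 (· * ·) ih h1).subset fun x hx => ?_
    obtain ⟨y, z, hy, hz, h⟩ := exists_mul_of_wordLength_le_add hx
    exact ⟨y, hy, z, hz, h⟩

theorem growthFunction_pos (hS : S.Finite) (n : ℕ) : 0 < growthFunction S n :=
  (Set.ncard_pos (finite_wordLength_le hS n)).2 ⟨1, wordLength_one_le n⟩

/-- Cutting words after `m` letters shows that products of the `m`-ball and the `n`-ball cover the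
`(m + n)`-ball. -/
theorem growthFunction_add_le (hS : S.Finite) (m n : ℕ) :
    growthFunction S (m + n) ≤ growthFunction S m * growthFunction S n := by
  have hm := finite_wordLength_le hS m
  have hn := finite_wordLength_le hS n
  unfold growthFunction
  rw [← Set.ncard_prod]
  refine (Set.ncard_le_ncard ?_ ((hm.prod hn).image fun x => x.1 * x.2)).trans
    (Set.ncard_image_le (hm.prod hn))
  intro x hx
  obtain ⟨y, z, hy, hz, h⟩ := exists_mul_of_wordLength_le_add hx
  exact ⟨(y, z), ⟨hy, hz⟩, h⟩

/-- For a finite generating set the limit defining the growth rate exists. -/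
theorem tendsto_growthRate (hS : S.Finite) :
    Tendsto (fun n : ℕ => (growthFunction S n : ℝ) ^ (1 / (n : ℝ))) atTop
      (𝓝 (growthRate S)) := by
  have hpos : ∀ n, (0 : ℝ) < growthFunction S n := fun n => by
    exact_mod_cast growthFunction_pos hS n
  have hsub : Subadditive fun n => Real.log (growthFunction S n) := fun m n => by
    rw [← Real.log_mul (hpos m).ne' (hpos n).ne']
    exact Real.log_le_log (hpos _) (by exact_mod_cast growthFunction_add_le hS m n)
  -- Fekete's lemma, applied to `log γ(n)`.
  have hlim := hsub.tendsto_lim ⟨0, by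
    rintro _ ⟨n, rfl⟩
    exact div_nonneg (Real.log_nonneg (by exact_mod_cast growthFunction_pos hS n))
      n.cast_nonneg⟩
  have h := (Real.continuous_exp.tendsto _).comp hlim
  have heq : (Real.exp ∘ fun n : ℕ => Real.log (growthFunction S n) / n) =
      fun n : ℕ => (growthFunction S n : ℝ) ^ (1 / (n : ℝ)) := by
    funext n
    rw [Function.comp_apply, Real.rpow_def_of_pos (hpos n), mul_one_div]
  rw [heq] at h
  rwa [growthRate, h.limsup_eq]

theorem card_filter_length_le_growthFunction (hS : S.Finite) {ι : Type*} [Fintype ι]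
    {F : ι → G} (hF : Function.Injective F) {len : ι → ℕ}
    (hlen : ∀ i, wordLength S (F i) ≤ len i) (m : ℕ) :
    (Finset.univ.filter fun i => len i = m).card ≤ growthFunction S m := by
  rw [← Set.ncard_coe_finset, ← Set.ncard_image_of_injective _ hF]
  refine Set.ncard_le_ncard ?_ (finite_wordLength_le hS m)
  rintro _ ⟨i, hi, rfl⟩
  have hi' : len i = m := by simpa using hi
  exact hi' ▸ hlen i

/-- If the free monoid on a finite alphabet, whose letters have positive lengths `len`, embeds into
a group without increasing lengths, and `∑ ρ⁻¹ ^ len = 1`, then the group has growth rate at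
least `ρ`. -/
theorem le_growthRate_of_injective (hS : S.Finite) {ι : Type*} [Fintype ι] {len : ι → ℕ}
    (hlen : ∀ i, 0 < len i) {F : List ι → G} (hF : Function.Injective F)
    (hFlen : ∀ l, wordLength S (F l) ≤ (l.map len).sum) {ρ : ℝ} (hρ : 0 < ρ)
    (hsum : ∑ i, ρ⁻¹ ^ len i = 1) : ρ ≤ growthRate S := by
  by_contra! hlt
  have hlim := tendsto_growthRate hS
  have h0 : 0 ≤ growthRate S :=
    ge_of_tendsto' hlim fun n => Real.rpow_nonneg (Nat.cast_nonneg _) _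
  obtain ⟨s, hs, hsρ⟩ := exists_between hlt
  have hs0 : 0 < s := h0.trans_lt hs
  have hx0 : 0 < s * ρ⁻¹ := by positivity
  have hx1 : s * ρ⁻¹ < 1 := by rw [← div_eq_mul_inv]; exact (div_lt_one hρ).2 hsρ
  obtain ⟨N, hN⟩ := eventually_atTop.1 (hlim.eventually_lt_const hs)
  have hbound : ∀ m, max N 1 ≤ m → (growthFunction S m : ℝ) ≤ s ^ m := fun m hm => by
    have hm1 : (m : ℝ) ≠ 0 := by
      have := (le_max_right N 1).trans hm
      positivity
    calc (growthFunction S m : ℝ) = ((growthFunction S m : ℝ) ^ (1 / (m : ℝ))) ^ m := by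
          rw [← Real.rpow_natCast, ← Real.rpow_mul (Nat.cast_nonneg _), one_div,
            inv_mul_cancel₀ hm1, Real.rpow_one]
      _ ≤ s ^ m := by
          gcongr
          exact (hN m ((le_max_left _ _).trans hm)).le
  -- Expand `1 = (∑ ρ⁻¹ ^ len) ^ n` over words of `n` letters and group them by total length `m ≥
  -- n`. Each group has at most `γ(m) ≤ s ^ m` words, so 1 is at most a geometric tail, which tends
  -- to 0.
  have key : ∀ n, max N 1 ≤ n → 1 ≤ (s * ρ⁻¹) ^ n * (1 - s * ρ⁻¹)⁻¹ := fun n hn => by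
    let Λ : (Fin n → ι) → ℕ := fun f => ∑ i, len (f i)
    obtain ⟨M, hM⟩ : ∃ M, ∀ f, Λ f < M :=
      ⟨Finset.univ.sup Λ + 1, fun f => Nat.lt_succ_of_le (Finset.le_sup (Finset.mem_univ f))⟩
    have hΛ : ∀ f, Λ f ∈ Finset.Ico n M := fun f => by
      refine Finset.mem_Ico.2 ⟨?_, hM f⟩
      calc n = ∑ _i : Fin n, 1 := by simp
        _ ≤ Λ f := Finset.sum_le_sum fun i _ => hlen (f i)
    calc (1 : ℝ) = ∏ _i : Fin n, ∑ j, ρ⁻¹ ^ len j := by rw [hsum]; simp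
      _ = ∑ f : Fin n → ι, ρ⁻¹ ^ Λ f := by
          rw [Finset.prod_univ_sum]
          simp [Λ, Finset.prod_pow_eq_pow_sum]
      _ = ∑ m ∈ Finset.Ico n M, ∑ f ∈ Finset.univ.filter fun f => Λ f = m, ρ⁻¹ ^ Λ f :=
          (Finset.sum_fiberwise_of_maps_to (fun f _ => hΛ f) _).symm
      _ ≤ ∑ m ∈ Finset.Ico n M, (s * ρ⁻¹) ^ m := by
          refine Finset.sum_le_sum fun m hm => ?_
          rw [Finset.sum_congr rfl (g := fun _ => ρ⁻¹ ^ m)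
            (fun f hf => by rw [(Finset.mem_filter.1 hf).2]), Finset.sum_const, nsmul_eq_mul,
            mul_pow]
          gcongr
          refine le_trans ?_ (hbound m (hn.trans (Finset.mem_Ico.1 hm).1))
          exact_mod_cast card_filter_length_le_growthFunction hS
            (hF.comp List.ofFn_injective) (fun f => by
              refine (hFlen _).trans_eq ?_
              simp [Λ, List.map_ofFn, List.sum_ofFn]) m
      _ ≤ (s * ρ⁻¹) ^ n * (1 - s * ρ⁻¹)⁻¹ := by
          rw [Finset.sum_Ico_eq_sum_range, ← tsum_geometric_of_lt_one hx0.le hx1,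
            ← tsum_mul_left]
          simp_rw [pow_add]
          exact ((summable_geometric_of_lt_one hx0.le hx1).mul_left _).sum_le_tsum _
            fun _ _ => by positivity
  have hzero : Tendsto (fun n : ℕ => (s * ρ⁻¹) ^ n * (1 - s * ρ⁻¹)⁻¹) atTop (𝓝 0) := by
    simpa using (tendsto_pow_atTop_nhds_zero_of_lt_one hx0.le hx1).mul_const (1 - s * ρ⁻¹)⁻¹
  exact absurd (ge_of_tendsto hzero (eventually_atTop.2 ⟨_, key⟩)) (by norm_num)

end WordGrowth

/-! ### Normal forms in `BS p q` and their coding by a free monoid. -/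

noncomputable section NormalForms

open HNNExtension HNNExtension.NormalWord Multiplicative

/-- The integers of least absolute value representing the residues modulo `m`. -/
def balancedResidues (m : ℕ) : Finset ℤ :=
  Finset.Ico (-((m / 2 : ℕ) : ℤ)) (((m + 1) / 2 : ℕ) : ℤ)

/-- The subgroup `⟨a ^ m⟩` of the infinite cyclic group `⟨a⟩`. -/
abbrev cyclicMultiples (m : ℕ) : Subgroup (Multiplicative ℤ) :=
  (powMonoidHom m : Multiplicative ℤ →* Multiplicative ℤ).range

theorem mem_cyclicMultiples {m : ℕ} {x : Multiplicative ℤ} :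
    x ∈ cyclicMultiples m ↔ (m : ℤ) ∣ toAdd x := by
  constructor
  · rintro ⟨y, rfl⟩
    exact ⟨toAdd y, by simp⟩
  · rintro ⟨c, hc⟩
    exact ⟨ofAdd c, by apply toAdd.injective; simp [hc]⟩

theorem powMonoidHom_int_injective {m : ℕ} (hm : 0 < m) :
    Function.Injective (powMonoidHom m : Multiplicative ℤ →* Multiplicative ℤ) := fun x y h => by
  have h' : (m : ℤ) * toAdd x = m * toAdd y := by simpa using congrArg toAdd h
  exact toAdd.injective (mul_left_cancel₀ (by positivity) h')

/-- The isomorphism `⟨a ^ p⟩ ≃* ⟨a ^ q⟩` sending `a ^ p` to `a ^ q`. -/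
def cyclicMultiplesEquiv {p q : ℕ} (hp : 0 < p) (hq : 0 < q) :
    cyclicMultiples p ≃* cyclicMultiples q :=
  (MonoidHom.ofInjective (powMonoidHom_int_injective hp)).symm.trans
    (MonoidHom.ofInjective (powMonoidHom_int_injective hq))

theorem cyclicMultiplesEquiv_apply {p q : ℕ} (hp : 0 < p) (hq : 0 < q)
    (h : ofAdd (1 : ℤ) ^ p ∈ cyclicMultiples p) :
    (cyclicMultiplesEquiv hp hq ⟨ofAdd (1 : ℤ) ^ p, h⟩ : Multiplicative ℤ) =
      ofAdd (1 : ℤ) ^ q := by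
  have : (⟨ofAdd (1 : ℤ) ^ p, h⟩ : cyclicMultiples p) =
      MonoidHom.ofInjective (powMonoidHom_int_injective hp) (ofAdd 1) := rfl
  rw [this, cyclicMultiplesEquiv, MulEquiv.trans_apply, MulEquiv.symm_apply_apply]
  rfl

/-- The modulus of the exponent of `a` that follows `t ^ u` in a normal word. -/
def sideModulus (p q : ℕ) (u : ℤˣ) : ℕ := if u = 1 then p else q

theorem sideModulus_pos {p q : ℕ} (hp : 0 < p) (hq : 0 < q) (u : ℤˣ) :
    0 < sideModulus p q u := by
  unfold sideModulus
  split_ifs <;> assumption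

theorem toSubgroup_cyclicMultiples (p q : ℕ) (u : ℤˣ) :
    toSubgroup (cyclicMultiples p) (cyclicMultiples q) u =
      cyclicMultiples (sideModulus p q u) := by
  unfold toSubgroup sideModulus
  split_ifs <;> rfl

theorem mem_balancedResidues_iff {m : ℕ} (hm : 0 < m) {r : ℤ} :
    r ∈ balancedResidues m ↔ r.bmod m = r := by
  rw [Int.bmod_eq_iff hm, balancedResidues, Finset.mem_Ico]
  simp only [sub_self, dvd_zero, and_true]
  omega

theorem isComplement_balancedResidues {m : ℕ} (hm : 0 < m) :
    Subgroup.IsComplement (cyclicMultiples m : Set (Multiplicative ℤ))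
      {x | toAdd x ∈ balancedResidues m} := by
  rw [Subgroup.isComplement_iff_existsUnique_mul_inv_mem]
  intro g
  refine ⟨⟨ofAdd ((toAdd g).bmod m), ?_⟩, ?_, ?_⟩
  · simp [mem_balancedResidues_iff hm]
  · refine mem_cyclicMultiples.2 ?_
    simpa [← sub_eq_add_neg] using Int.dvd_self_sub_bmod
  · rintro ⟨y, hy⟩ h
    rw [SetLike.mem_coe, mem_cyclicMultiples, toAdd_mul, toAdd_inv, ← sub_eq_add_neg,
      Int.dvd_iff_bmod_eq_zero, ← Int.bmod_eq_bmod_iff_bmod_sub_eq_zero] at h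
    rw [Set.mem_ofPred_eq, mem_balancedResidues_iff hm] at hy
    ext1
    apply toAdd.injective
    rw [toAdd_ofAdd, h, hy]

/-- The balanced residues as transversals for the HNN extension structure of `BS(p,q)`. -/
def balancedTransversal {p q : ℕ} (hp : 0 < p) (hq : 0 < q) :
    TransversalPair (Multiplicative ℤ) (cyclicMultiples p) (cyclicMultiples q) where
  set u := {x | toAdd x ∈ balancedResidues (sideModulus p q u)}
  compl u := by
    rw [toSubgroup_cyclicMultiples]
    exact isComplement_balancedResidues (sideModulus_pos hp hq u)

/-- The canonical homomorphism from `BS(p,q)` to the corresponding HNN extension of `ℤ`. -/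
def BS.toHNN {p q : ℕ} (hp : 0 < p) (hq : 0 < q) :
    BS p q →* HNNExtension (Multiplicative ℤ) (cyclicMultiples p) (cyclicMultiples q)
      (cyclicMultiplesEquiv hp hq) :=
  PresentedGroup.toGroup
    (f := fun g => match g with
      | BSGen.a => HNNExtension.of (ofAdd 1)
      | BSGen.t => HNNExtension.t) (by
    rintro _ rfl
    have hmem : ofAdd (1 : ℤ) ^ p ∈ cyclicMultiples p := ⟨ofAdd 1, rfl⟩
    have h := (congrArg HNNExtension.of (cyclicMultiplesEquiv_apply hp hq hmem)).symm.trans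
      (equiv_eq_conj (φ := cyclicMultiplesEquiv hp hq) ⟨_, hmem⟩)
    simp only [map_mul, map_pow, map_inv, FreeGroup.lift_apply_of] at h ⊢
    rw [← h, mul_inv_cancel])

@[simp]
theorem BS.toHNN_a {p q : ℕ} (hp : 0 < p) (hq : 0 < q) :
    BS.toHNN hp hq (PresentedGroup.of BSGen.a) = HNNExtension.of (ofAdd 1) :=
  PresentedGroup.toGroup.of _

@[simp]
theorem BS.toHNN_t {p q : ℕ} (hp : 0 < p) (hq : 0 < q) :
    BS.toHNN hp hq (PresentedGroup.of BSGen.t) = HNNExtension.t :=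
  PresentedGroup.toGroup.of _

/-- Letters coding normal words: `none` stands for a syllable `t ^ u` whose sign `u` repeats that of
the next syllable, and `some ⟨u, r⟩` for a syllable `t ^ u * a ^ r` with `r ≠ 0`. -/
abbrev Syllable (p q : ℕ) : Type :=
  Option (Σ u : ℤˣ, {r // r ∈ (balancedResidues (sideModulus p q u)).erase 0})

/-- The length of the word in `a`, `t` spelled by a syllable. -/
def Syllable.length {p q : ℕ} : Syllable p q → ℕ
  | none => 1
  | some s => 1 + s.2.1.natAbs

/-- The list of syllables `t ^ u * a ^ r` of the normal word with a given code. -/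
def Syllable.decode {p q : ℕ} : List (Syllable p q) → List (ℤˣ × Multiplicative ℤ)
  | [] => []
  -- The default sign 1 occurs only at the end of the word, where no sign condition applies.
  | none :: l => (((decode l).head?.map Prod.fst).getD 1, 1) :: decode l
  | some s :: l => (s.1, ofAdd s.2.1) :: decode l

theorem Syllable.length_pos {p q : ℕ} (s : Syllable p q) : 0 < s.length := by
  cases s <;> simp [Syllable.length]

/-- Blank letters are recognised by exponent 0, which no other letter has, and carry no further
information. -/
theorem Syllable.decode_injective {p q : ℕ} :
    Function.Injective (Syllable.decode : List (Syllable p q) → _) := by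
  intro l
  induction l with
  | nil =>
    rintro (_ | ⟨_ | s, l'⟩) h
    · rfl
    · simp [decode] at h
    · simp [decode] at h
  | cons s l ih =>
    rintro (_ | ⟨s', l'⟩) h
    · cases s <;> simp [decode] at h
    · rcases s with _ | ⟨u, r, hr⟩ <;> rcases s' with _ | ⟨u', r', hr'⟩ <;>
        simp only [decode, List.cons.injEq, Prod.mk.injEq] at h
      · rw [ih h.2]
      · exact absurd (ofAdd_eq_one.1 h.1.2.symm) (Finset.ne_of_mem_erase hr')
      · exact absurd (ofAdd_eq_one.1 h.1.2) (Finset.ne_of_mem_erase hr)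
      · obtain ⟨⟨rfl, h2⟩, h3⟩ := h
        obtain rfl := ofAdd.injective h2
        rw [ih h3]

/-- A nonzero balanced residue is not a multiple of its modulus, so the condition bites only at
blanks, whose sign was copied to satisfy it. -/
theorem Syllable.isChain_decode {p q : ℕ} (hp : 0 < p) (hq : 0 < q) (l : List (Syllable p q)) :
    (decode l).IsChain fun x y =>
      x.2 ∈ toSubgroup (cyclicMultiples p) (cyclicMultiples q) x.1 → x.1 = y.1 := by
  induction l with
  | nil => exact List.isChain_nil
  | cons s l ih =>
    rcases s with _ | ⟨u, r, hr⟩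
    · refine List.isChain_cons.2 ⟨fun y hy _ => ?_, ih⟩
      rw [Option.mem_def] at hy
      simp [hy]
    · refine List.isChain_cons.2 ⟨fun y _ hmem => ?_, ih⟩
      rw [toSubgroup_cyclicMultiples, mem_cyclicMultiples, toAdd_ofAdd,
        Int.dvd_iff_bmod_eq_zero] at hmem
      have hr' := Finset.mem_erase.1 hr
      rw [mem_balancedResidues_iff (sideModulus_pos hp hq u)] at hr'
      exact absurd (hr'.2.symm.trans hmem) hr'.1

theorem Syllable.mem_balancedTransversal_of_mem_decode {p q : ℕ} (hp : 0 < p) (hq : 0 < q)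
    (l : List (Syllable p q)) (u : ℤˣ) (g : Multiplicative ℤ) (h : (u, g) ∈ decode l) :
    g ∈ (balancedTransversal hp hq).set u := by
  induction l with
  | nil => simp [decode] at h
  | cons s l ih =>
    rcases s with _ | ⟨u', r, hr⟩ <;>
      simp only [decode, List.mem_cons, Prod.mk.injEq] at h
    · rcases h with ⟨-, rfl⟩ | h
      · show toAdd 1 ∈ balancedResidues _
        rw [mem_balancedResidues_iff (sideModulus_pos hp hq u)]
        simp
      · exact ih h
    · rcases h with ⟨rfl, rfl⟩ | h
      · exact Finset.mem_of_mem_erase hr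
      · exact ih h

/-- The normal word with a given code. -/
def Syllable.normalWord {p q : ℕ} (hp : 0 < p) (hq : 0 < q) (l : List (Syllable p q)) :
    NormalWord (balancedTransversal hp hq) where
  head := 1
  toList := decode l
  chain := isChain_decode hp hq l
  mem_set := mem_balancedTransversal_of_mem_decode hp hq l

/-- The element of `BS(p,q)` represented by the normal word with a given code. -/
def Syllable.eval {p q : ℕ} (l : List (Syllable p q)) : BS p q :=
  ((decode l).map fun x =>
    PresentedGroup.of BSGen.t ^ (x.1 : ℤ) * PresentedGroup.of BSGen.a ^ toAdd x.2).prod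

theorem Syllable.toHNN_eval {p q : ℕ} (hp : 0 < p) (hq : 0 < q) (l : List (Syllable p q)) :
    BS.toHNN hp hq (eval l) = (normalWord hp hq l).prod (cyclicMultiplesEquiv hp hq) := by
  rw [eval, map_list_prod, ReducedWord.prod, List.map_map]
  simp only [normalWord, map_one, one_mul]
  congr 2
  funext x
  simp only [Function.comp_apply, map_mul, map_zpow, BS.toHNN_a, BS.toHNN_t]
  rw [← map_zpow, ← ofAdd_zsmul]
  simp

/-- The normal form theorem separates the images in the HNN extension; injectivity of `BS.toHNN` is
not needed. -/
theorem Syllable.eval_injective {p q : ℕ} (hp : 0 < p) (hq : 0 < q) :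
    Function.Injective (eval : List (Syllable p q) → BS p q) := fun l l' h => by
  have h' := congrArg (BS.toHNN hp hq) h
  rw [toHNN_eval, toHNN_eval] at h'
  have := prod_injective (cyclicMultiplesEquiv hp hq) (balancedTransversal hp hq) h'
  exact decode_injective (congrArg (fun w => w.toList) this)

theorem BS.wordLength_syllable_le {p q : ℕ} (u : ℤˣ) (r : ℤ) :
    wordLength (BS.gens p q)
      (PresentedGroup.of BSGen.t ^ (u : ℤ) * PresentedGroup.of BSGen.a ^ r) ≤
        (1 + r.natAbs : ℕ) := by
  have ha : (PresentedGroup.of BSGen.a : BS p q) ∈ BS.gens p q := Or.inl rfl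
  have ht : (PresentedGroup.of BSGen.t : BS p q) ∈ BS.gens p q := Or.inr rfl
  refine wordLength_mul_le ?_ (wordLength_zpow_le ha r)
  have := wordLength_zpow_le ht u
  rwa [Int.units_natAbs] at this

theorem Syllable.wordLength_eval_le {p q : ℕ} (l : List (Syllable p q)) :
    wordLength (BS.gens p q) (eval l) ≤ (l.map Syllable.length).sum := by
  induction l with
  | nil => exact wordLength_one_le _
  | cons s l ih =>
    rw [List.map_cons, List.sum_cons]
    cases s with
    | none => exact wordLength_mul_le (BS.wordLength_syllable_le _ 0) ih
    | some s => exact wordLength_mul_le (BS.wordLength_syllable_le _ _) ih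

end NormalForms

/-! ### The generating function of the syllables and the zeros of `growthPoly`. -/

section GrowthPolynomial

theorem balancedResidues_erase_zero (m : ℕ) :
    (balancedResidues m).erase 0 =
      (Finset.Icc 1 (m / 2)).image (fun i : ℕ => -(i : ℤ)) ∪
        (Finset.Icc 1 ((m - 1) / 2)).image (fun i : ℕ => (i : ℤ)) := by
  ext r
  simp only [balancedResidues, Finset.mem_erase, Finset.mem_Ico, Finset.mem_union,
    Finset.mem_image, Finset.mem_Icc]
  constructor
  · intro h
    rcases le_total r 0 with h0 | h0
    · exact .inl ⟨r.natAbs, by omega, by omega⟩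
    · exact .inr ⟨r.natAbs, by omega, by omega⟩
  · rintro (⟨i, hi, rfl⟩ | ⟨i, hi, rfl⟩) <;> omega

/-- Each absolute value below `m / 2` occurs with both signs; the top value `m / 2` does so only for
odd `m`, which explains `parityConst`. -/
theorem sum_balancedResidues_erase_zero {m : ℕ} (hm : 2 ≤ m) (z : ℝ) :
    ∑ r ∈ (balancedResidues m).erase 0, z ^ r.natAbs =
      2 * ∑ i ∈ Finset.Icc 1 (m / 2 - 1), z ^ i + parityConst m * z ^ (m / 2) := by
  have hdisj : Disjoint ((Finset.Icc 1 (m / 2)).image (fun i : ℕ => -(i : ℤ)))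
      ((Finset.Icc 1 ((m - 1) / 2)).image (fun i : ℕ => (i : ℤ))) := by
    simp only [Finset.disjoint_left, Finset.mem_image, Finset.mem_Icc]
    rintro _ ⟨i, hi, rfl⟩ ⟨j, hj, h⟩
    omega
  rw [balancedResidues_erase_zero, Finset.sum_union hdisj,
    Finset.sum_image (fun i _ j _ h => by simpa using h),
    Finset.sum_image (fun i _ j _ h => by simpa using h)]
  simp only [Int.natAbs_neg, Int.natAbs_natCast]
  have htop : ∑ i ∈ Finset.Icc 1 (m / 2), z ^ i =
      ∑ i ∈ Finset.Icc 1 (m / 2 - 1), z ^ i + z ^ (m / 2) := by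
    obtain ⟨k, hk⟩ : ∃ k, m / 2 = k + 1 := ⟨m / 2 - 1, by omega⟩
    rw [hk, Finset.sum_Icc_succ_top (by omega), Nat.add_sub_cancel]
  unfold parityConst
  split_ifs with he
  · rw [show (m - 1) / 2 = m / 2 - 1 by have := he.two_dvd; omega, htop]
    ring
  · rw [show (m - 1) / 2 = m / 2 by have := Nat.not_even_iff.1 he; omega, htop]
    ring

theorem pow_mul_sum_inv_pow {x : ℝ} (hx : x ≠ 0) {j l : ℕ} (hj : 1 ≤ j) (hjl : j ≤ l) :
    x ^ l * ∑ i ∈ Finset.Icc 1 (j - 1), x⁻¹ ^ i =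
      ∑ i ∈ Finset.Icc (l - j + 1) (l - 1), x ^ i := by
  rw [Finset.mul_sum]
  refine Finset.sum_nbij' (fun i => l - i) (fun i => l - i) ?_ ?_ ?_ ?_ ?_
  · intro i hi; simp only [Finset.mem_Icc] at hi ⊢; omega
  · intro i hi; simp only [Finset.mem_Icc] at hi ⊢; omega
  · intro i hi; simp only [Finset.mem_Icc] at hi; omega
  · intro i hi; simp only [Finset.mem_Icc] at hi; omega
  · intro i hi
    simp only [Finset.mem_Icc] at hi
    rw [pow_sub₀ x hx (by omega), inv_pow]

/-- The cases `p = 2, 3` are the general formula at `k = 1`, where the first sum is empty. -/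
theorem eval_growthPoly {p q : ℕ} (hp : 2 ≤ p) (hpq : p ≤ q) (x : ℝ) :
    (growthPoly p q).eval x =
      x ^ (q / 2 + 1) - x ^ (q / 2)
        - 2 * ∑ i ∈ Finset.Icc (q / 2 - p / 2 + 1) (q / 2 - 1), x ^ i
        - parityConst p * x ^ (q / 2 - p / 2) - 2 * ∑ i ∈ Finset.Icc 1 (q / 2 - 1), x ^ i
        - parityConst q := by
  have hIcc : ∀ l, 1 ≤ l → Finset.Icc (l - 1 + 1) (l - 1) = ∅ := fun l hl =>
    Finset.Icc_eq_empty (by omega)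
  have h2 : parityConst 2 = 1 := if_pos even_two
  have h3 : parityConst 3 = 2 := if_neg (by decide)
  by_cases h4 : 4 ≤ p
  · simp [growthPoly, h4, eval_finsetSum]
  · obtain rfl | rfl : p = 2 ∨ p = 3 := by omega
    · rw [show 2 / 2 = 1 from rfl, hIcc _ (by omega), h2]
      by_cases hq2 : q = 2
      · subst hq2
        norm_num [growthPoly, h2]
        ring
      · by_cases hq3 : q = 3
        · subst hq3
          norm_num [growthPoly, h3]
          ring
        · simp [growthPoly, hq2, hq3, eval_finsetSum]
    · rw [show 3 / 2 = 1 from rfl, hIcc _ (by omega), h3]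
      by_cases hq3 : q = 3
      · subst hq3
        norm_num [growthPoly, h3]
        ring
      · simp [growthPoly, hq3, eval_finsetSum]

theorem Syllable.sum_pow_length {p q : ℕ} (z : ℝ) :
    ∑ s : Syllable p q, z ^ s.length =
      z * (1 + ∑ r ∈ (balancedResidues p).erase 0, z ^ r.natAbs +
        ∑ r ∈ (balancedResidues q).erase 0, z ^ r.natAbs) := by
  rw [Fintype.sum_option, Fintype.sum_sigma]
  have h : ∀ u : ℤˣ, (∑ r : {r // r ∈ (balancedResidues (sideModulus p q u)).erase 0},
      z ^ Syllable.length (p := p) (q := q) (some ⟨u, r⟩)) =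
        z * ∑ r ∈ (balancedResidues (sideModulus p q u)).erase 0, z ^ r.natAbs := fun u => by
    rw [Finset.mul_sum,
      ← Finset.sum_coe_sort _ fun r : ℤ => z * z ^ r.natAbs]
    exact Finset.sum_congr rfl fun r _ => by simp only [Syllable.length, pow_add, pow_one]
  have hne : (-1 : ℤˣ) ≠ 1 := by decide
  simp only [h, UnitsInt.univ, Finset.sum_pair hne.symm]
  simp only [Syllable.length, sideModulus, if_true, if_neg hne]
  ring

/-- The growth polynomial in terms of the generating function of the syllables. -/
theorem eval_growthPoly_eq_mul {p q : ℕ} (hp : 2 ≤ p) (hpq : p ≤ q) {x : ℝ} (hx : x ≠ 0) :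
    (growthPoly p q).eval x =
      x ^ (q / 2 + 1) * (1 - ∑ s : Syllable p q, x⁻¹ ^ s.length) := by
  have hk : p / 2 ≤ q / 2 := Nat.div_le_div_right hpq
  have h1 := pow_mul_sum_inv_pow hx (j := p / 2) (l := q / 2) (by omega) hk
  have h2 := pow_mul_sum_inv_pow hx (j := q / 2) (l := q / 2) (by omega) le_rfl
  have h3 : x ^ (q / 2 - p / 2) = x ^ (q / 2) * x⁻¹ ^ (p / 2) := by
    rw [pow_sub₀ x hx hk, inv_pow]
  have h4 : x ^ (q / 2) * x⁻¹ ^ (q / 2) = 1 := by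
    rw [← mul_pow, mul_inv_cancel₀ hx, one_pow]
  have h5 : x ^ (q / 2 + 1) * x⁻¹ = x ^ (q / 2) := by
    rw [pow_succ, mul_assoc, mul_inv_cancel₀ hx, mul_one]
  rw [Nat.sub_self, zero_add] at h2
  rw [eval_growthPoly hp hpq, Syllable.sum_pow_length, sum_balancedResidues_erase_zero hp,
    sum_balancedResidues_erase_zero (hp.trans hpq), mul_sub, ← mul_assoc, h5, ← h1, ← h2, h3]
  linear_combination parityConst q * h4

theorem Syllable.card_eq {p q : ℕ} (hp : 2 ≤ p) (hpq : p ≤ q) :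
    Fintype.card (Syllable p q) = p + q - 1 := by
  have hcard : ∀ m, 2 ≤ m → ((balancedResidues m).erase 0).card = m - 1 := fun m hm => by
    rw [Finset.card_erase_of_mem, balancedResidues, Int.card_Ico]
    · omega
    · rw [balancedResidues, Finset.mem_Ico]; omega
  have h := Syllable.sum_pow_length (p := p) (q := q) 1
  simp only [one_pow, Finset.sum_const, nsmul_eq_mul, mul_one, one_mul, Finset.card_univ,
    hcard p hp, hcard q (hp.trans hpq)] at h
  have h' : Fintype.card (Syllable p q) = 1 + (p - 1) + (q - 1) := by exact_mod_cast h
  omega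

/-- The sign changes on `[1, p + q]`: with `p + q - 1` syllables of length at least 1, `f(1) = p + q
- 1 > 1` and `f(1/(p + q)) ≤ (p + q - 1)/(p + q) < 1`. -/
theorem exists_isGreatest_root_growthPoly {p q : ℕ} (hp : 2 ≤ p) (hpq : p ≤ q) :
    ∃ ρ : ℝ, 1 ≤ ρ ∧ IsGreatest {x : ℝ | (growthPoly p q).IsRoot x} ρ := by
  have hcard := Syllable.card_eq hp hpq
  have hone : (growthPoly p q).eval 1 < 0 := by
    have hc : (1 : ℝ) < Fintype.card (Syllable p q) := by exact_mod_cast (by omega)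
    rw [eval_growthPoly_eq_mul hp hpq one_ne_zero]
    simp only [one_pow, inv_one, one_mul, Finset.sum_const, Finset.card_univ, nsmul_eq_mul,
      mul_one]
    linarith
  have hpq0 : (0 : ℝ) < p + q := by exact_mod_cast (by omega)
  have hpq1 : (1 : ℝ) ≤ p + q := by exact_mod_cast (by omega)
  have hbig : 0 < (growthPoly p q).eval ((p : ℝ) + q) := by
    rw [eval_growthPoly_eq_mul hp hpq hpq0.ne']
    refine mul_pos (by positivity) (sub_pos.2 ?_)
    calc ∑ s : Syllable p q, ((p : ℝ) + q)⁻¹ ^ s.length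
        ≤ ∑ _s : Syllable p q, ((p : ℝ) + q)⁻¹ :=
          Finset.sum_le_sum fun s _ => pow_le_of_le_one (by positivity)
            (inv_le_one_of_one_le₀ hpq1) s.length_pos.ne'
      _ = Fintype.card (Syllable p q) / ((p : ℝ) + q) := by
          rw [Finset.sum_const, Finset.card_univ, nsmul_eq_mul, div_eq_mul_inv]
      _ < 1 := by
          rw [div_lt_one hpq0]
          exact_mod_cast (by omega)
  have hne : growthPoly p q ≠ 0 := fun h => by simp [h] at hone
  obtain ⟨y, hy, hroot⟩ := intermediate_value_Icc hpq1 (growthPoly p q).continuous.continuousOn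
    ⟨hone.le, hbig.le⟩
  obtain ⟨ρ, hρ, hmax⟩ := Set.exists_max_image {x : ℝ | (growthPoly p q).IsRoot x} id
    (Polynomial.finite_setOfPred_isRoot hne) ⟨y, hroot⟩
  exact ⟨ρ, hy.1.trans (hmax y hroot), hρ, hmax⟩

end GrowthPolynomial

theorem theorem5p2 (p q : ℕ) (hp : 2 ≤ p) (hpq : p ≤ q) :
    Tendsto (fun n : ℕ => (growthFunction (BS.gens p q) n : ℝ) ^ (1 / (n : ℝ))) atTop
        (𝓝 (growthRate (BS.gens p q))) ∧
      ∃ ρ : ℝ, IsGreatest {x : ℝ | (growthPoly p q).IsRoot x} ρ ∧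
        ρ ≤ growthRate (BS.gens p q) := by
  have hfin : (BS.gens p q).Finite := (Set.finite_singleton _).insert _
  have hp0 : 0 < p := by omega
  have hq0 : 0 < q := by omega
  obtain ⟨ρ, hρ1, hρ⟩ := exists_isGreatest_root_growthPoly hp hpq
  have hρ0 : 0 < ρ := by linarith
  refine ⟨tendsto_growthRate hfin, ρ, hρ, ?_⟩
  refine le_growthRate_of_injective hfin (len := Syllable.length) Syllable.length_pos
    (Syllable.eval_injective hp0 hq0) Syllable.wordLength_eval_le hρ0 ?_
  have hroot : (growthPoly p q).eval ρ = 0 := hρ.1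
  rw [eval_growthPoly_eq_mul hp hpq hρ0.ne', mul_eq_zero] at hroot
  linarith [hroot.resolve_left (by positivity)]
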